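/- **Setting.** Let $\mathcal N=\mathcal B\sqcup\mathcal R$ be a finite set of nodes (consumers $\mathcal B$, retailers $\mathcal R$) of a connected undirected graph. Each line $\{i,j\}$ has a resistance $R_{ij}=R_{ji}>0$ and each node a shunt resistance $R_{ii}>0$; put $1/R_{ij}=0$ when $i\ne j$ are not joined by a line. Let $G=\mathcal L+\mathrm{diag}(1/R_{ii})$, where $\mathcal L=D-A$ is the Laplacian of the graph with weights $A_{ij}=1/R_{ij}$ ($i\neq j$) and $D=\mathrm{diag}(\sum_jA_{ij})$. Let $\tau_{v,i},k_i,\Delta V_i>0$ for $i\in\mathcal N$, $\tau_b>0$ for $b\in\mathcal B$, $V^*\in\mathbb R$, and let $P^{\rm set}_r\in\mathbb R$ ($r\in\mathcal R$) and $P^d_b\in\mathbb R$ ($b\in\mathcal B$) be constants. Consider, with state $x=(V,P)$, $V=(V_i)_{i\in\mathcal N}$, $P=(P^{\rm set}_b)_{b\in\mathcal B}$, the system $$\tau_{v,i}\dot V_i=\Big(V^*-V_i-k_i\sum_{j\in\mathcal N}G_{ij}V_iV_j+k_iP_i^{\rm set}\Big)\Big(1-\frac{(V_i-V^*)^2}{\Delta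 V_i^2}\Big)\quad(i\in\mathcal N),\qquad \tau_b\dot P^{\rm set}_b=P^d_b-P^{\rm set}_b\quad(b\in\mathcal B).$$ **Proposition.** Let $\bar x=(\bar V,\bar P)$ be an equilibrium of this system strictly inside the voltage bounds, i.e. $|\bar V_i-V^*|<\Delta V_i$ for all $i\in\mathcal N$, with nonnegative voltages $\bar V_i\ge 0$ (automatic if $V^*\ge\Delta V_i$ for all $i$). Let $\Delta V$ be a real number with $|\bar V_i-V^*|\le\Delta V$ for all $i$ (for instance $\Delta V=\max_i\Delta V_i$, the common bound when all $\Delta V_i$ are equal). If $$k_i\,\Delta V\sum_{j\in\mathcal N}\frac1{R_{ij}}<\frac12+k_i\frac{V^*}{R_{ii}}\qquad\text{for all } i\in\mathcal N$$ (the sum includes $j=i$), then $\bar x$ is locally asymptotically stable: there is a neighbourhood $\mathcal A$ of $\bar x$ such that for every $x_0\in\mathcal A$ a solution on $[0,\infty)$ with $x(0)=x_0$ exists and every such solution satisfies $\lim_{t\to\infty}|x(t)-\bar x|=0$; and for every $\varepsilon>0$ there is $\delta>0$ such that every solution on $[0,\infty)$ with $|x(0)-\bar x|<\delta$ satisfies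 $|x(t)-\bar x|<\varepsilon$ for all $t\ge0$. -/

import Mathlib

open Filter Topology

/-- A resistive power network: a connected undirected graph on the node set `N`, a resistance
`R i j > 0` for every line `(i, j)` and a shunt resistance `R i i > 0` at every node.
(The values `R i j` for distinct non-adjacent `i, j` carry no meaning and are never used.) -/
structure ResistiveNetwork (N : Type*) where
  graph : SimpleGraph N
  connected : graph.Connected
  R : N → N → ℝ
  R_symm : ∀ i j, graph.Adj i j → R i j = R j i
  R_line_pos : ∀ i j, graph.Adj i j → 0 < R i j
  R_shunt_pos : ∀ i, 0 < R i i

namespace ResistiveNetwork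

variable {N : Type*} [Fintype N] [DecidableEq N]

open scoped Classical in
/-- The weighted adjacency matrix: the conductance `1 / R i j` for a line, `0` otherwise. -/
noncomputable def adjacency (S : ResistiveNetwork N) : Matrix N N ℝ :=
  Matrix.of fun i j => if S.graph.Adj i j then 1 / S.R i j else 0

/-- The weighted graph Laplacian `D - A`. -/
noncomputable def laplacian (S : ResistiveNetwork N) : Matrix N N ℝ :=
  Matrix.diagonal (fun i => ∑ j, S.adjacency i j) - S.adjacency

/-- The network conductance matrix `G = L + diag(1 / R i i)`. -/
noncomputable def conductance (S : ResistiveNetwork N) : Matrix N N ℝ :=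
  S.laplacian + Matrix.diagonal (fun i => 1 / S.R i i)

open scoped Classical in
/-- The number `1 / R i j`, for `i = j` (shunt) and for lines; it is `0` (infinite resistance)
for two distinct nodes without a line between them. -/
noncomputable def invR (S : ResistiveNetwork N) (i j : N) : ℝ :=
  if i = j ∨ S.graph.Adj i j then 1 / S.R i j else 0

end ResistiveNetwork

/-- A micro-grid with consumers `B` and retailers `Q`; the nodes are `B ⊕ Q`.
All inputs (retailer set-points and consumer demands) are constant. -/
structure MicroGrid (B Q : Type*) where
  /-- the electrical network on all nodes -/
  net : ResistiveNetwork (B ⊕ Q)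
  /-- rated voltage -/
  Vstar : ℝ
  /-- voltage bounds of the bounded integrators -/
  ΔV : B ⊕ Q → ℝ
  /-- time constants of the voltage dynamics -/
  τv : B ⊕ Q → ℝ
  /-- droop coefficients -/
  k : B ⊕ Q → ℝ
  /-- time constants of the demand response -/
  τ : B → ℝ
  /-- constant power set-points of the retailers -/
  Pr : Q → ℝ
  /-- constant demands of the consumers -/
  Pd : B → ℝ
  ΔV_pos : ∀ i, 0 < ΔV i
  τv_pos : ∀ i, 0 < τv i
  k_pos : ∀ i, 0 < k i
  τ_pos : ∀ b, 0 < τ b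

namespace MicroGrid

variable {B Q : Type*} [Fintype B] [Fintype Q] [DecidableEq B] [DecidableEq Q]

/-- The state `(V, P)`: voltages at all nodes and power references of the consumers. -/
abbrev State (B Q : Type*) : Type _ := (B ⊕ Q → ℝ) × (B → ℝ)

/-- Right-hand side for `V i`: bounded-integral droop control. -/
noncomputable def voltageField (g : MicroGrid B Q) (x : State B Q) (i : B ⊕ Q) : ℝ :=
  (g.τv i)⁻¹ *
    ((g.Vstar - x.1 i - g.k i * ∑ j, g.net.conductance i j * x.1 i * x.1 j
        + g.k i * Sum.elim x.2 g.Pr i) *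
      (1 - (x.1 i - g.Vstar) ^ 2 / g.ΔV i ^ 2))

/-- Right-hand side for the consumers' power references: first-order demand response. -/
noncomputable def demandField (g : MicroGrid B Q) (x : State B Q) (b : B) : ℝ :=
  (g.τ b)⁻¹ * (g.Pd b - x.2 b)

/-- The coupled vector field. -/
noncomputable def field (g : MicroGrid B Q) (x : State B Q) : State B Q :=
  (g.voltageField x, g.demandField x)

/-- `x` is a solution of the coupled system on `[0, ∞)`. -/
def IsSolution (g : MicroGrid B Q) (x : ℝ → State B Q) : Prop :=
  IsIntegralCurveOn x (fun _ => g.field) (Set.Ici 0)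

/-- `xbar` is an equilibrium point of the coupled system. -/
def IsEquilibrium (g : MicroGrid B Q) (xbar : State B Q) : Prop :=
  g.field xbar = 0

end MicroGrid

/-! In error coordinates `e = x - xbar`, the voltage field is exactly a positive gain times a linear
expression in `e` whose coefficients depend on `x` (`IsEquilibrium.voltageField_eq`). Its
off-diagonal coefficients come from the lines and from the power references. Measure errors by the
weighted sup norm `max(‖e.1‖, s‖e.2‖)`: a large `s` makes the power coupling `k i / s` negligible,
and stability reduces to row diagonal dominance of the voltage block. The hypothesis on the
resistances is what yields this dominance (`margin_pos`), and it persists near `xbar` by continuity.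
Dominance makes a small explicit Euler step contract the norm by `1 - α * h`
(`IsEquilibrium.norm_euler_step_le`), a logarithmic-norm estimate needing no linearization or
Lyapunov function. A comparison argument turns it into exponential decay. Solutions exist because a
truncated, globally solvable field agrees with the original one on a ball that its solutions never
leave. -/

/-! ### Global solutions and decay under infinitesimal contraction -/

/-- A bounded, globally Lipschitz autonomous vector field has a solution on `[0, ∞)` through every
point. -/
theorem LipschitzWith.exists_isIntegralCurveOn_Ici {E : Type*} [NormedAddCommGroup E]
    [NormedSpace ℝ E] [CompleteSpace E] {f : E → E} {K M : NNReal} (hf : LipschitzWith K f)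
    (hM : ∀ x, ‖f x‖ ≤ M) (x₀ : E) :
    ∃ x : ℝ → E, x 0 = x₀ ∧ IsIntegralCurveOn x (fun _ => f) (Set.Ici 0) := by
  have key : ∀ n : ℕ, ∃ y : ℝ → E, y 0 = x₀ ∧
      ∀ t ∈ Set.Icc (0 : ℝ) n, HasDerivWithinAt y (f (y t)) (Set.Icc (0 : ℝ) n) t := by
    intro n
    have hpl : IsPicardLindelof (fun _ => f) (tmin := 0) (tmax := n)
        ⟨0, le_rfl, Nat.cast_nonneg n⟩ x₀ (M * n) 0 M K :=
      IsPicardLindelof.of_time_independent (fun x _ => hM x) hf.lipschitzOnWith (by simp)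
    exact hpl.exists_eq_forall_mem_Icc_hasDerivWithinAt₀
  choose y hy0 hy using key
  have mono : ∀ m n : ℕ, m ≤ n → Set.EqOn (y m) (y n) (Set.Icc 0 (m : ℝ)) := by
    intro m n hmn
    have hsub : Set.Icc (0 : ℝ) m ⊆ Set.Icc (0 : ℝ) n :=
      Set.Icc_subset_Icc_right (by exact_mod_cast hmn)
    have hder : ∀ k : ℕ, m ≤ k → ∀ t ∈ Set.Ico (0 : ℝ) m,
        HasDerivWithinAt (y k) (f (y k t)) (Set.Ici t) t := by
      intro k hk t ht
      have htk : t < k := ht.2.trans_le (by exact_mod_cast hk)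
      exact (hy k t ⟨ht.1, htk.le⟩).mono_of_mem_nhdsWithin
        (mem_of_superset (Icc_mem_nhdsGE htk) (Set.Icc_subset_Icc_left ht.1))
    exact ODE_solution_unique (v := fun _ => f) (fun _ => hf)
      (fun t ht => (hy m t ht).continuousWithinAt) (hder m le_rfl)
      (fun t ht => (hy n t (hsub ht)).continuousWithinAt.mono hsub) (hder n hmn)
      ((hy0 m).trans (hy0 n).symm)
  -- The `+ 1` puts `t` strictly below the endpoint, so the interval is a neighbourhood of `t`
  -- within `[0, ∞)`.
  refine ⟨fun t => y (⌊t⌋₊ + 1) t, hy0 _, fun t ht => ?_⟩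
  have ht0 : (0 : ℝ) ≤ t := ht
  have htn : t < ((⌊t⌋₊ + 1 : ℕ) : ℝ) := by exact_mod_cast Nat.lt_floor_add_one t
  have hmem : Set.Icc (0 : ℝ) ((⌊t⌋₊ + 1 : ℕ) : ℝ) ∈ 𝓝[Set.Ici 0] t := by
    filter_upwards [self_mem_nhdsWithin, mem_nhdsWithin_of_mem_nhds (Iio_mem_nhds htn)]
      with s hs hs' using ⟨hs, le_of_lt hs'⟩
  refine ((hy _ t ⟨ht0, htn.le⟩).mono_of_mem_nhdsWithin hmem).congr_of_eventuallyEq ?_ rfl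
  filter_upwards [self_mem_nhdsWithin, mem_nhdsWithin_of_mem_nhds (Iio_mem_nhds htn)] with s hs hs'
  have hs0 : (0 : ℝ) ≤ s := hs
  refine mono _ _ ?_ ⟨hs0, by exact_mod_cast (Nat.lt_floor_add_one s).le⟩
  have : ⌊s⌋₊ < ⌊t⌋₊ + 1 := (Nat.floor_lt hs0).2 hs'
  omega

/-- If a differentiable curve satisfies an infinitesimal contraction estimate as long as it stays
in the closed ball of radius `r`, then it decays exponentially when started in that ball. -/
theorem norm_le_exp_of_infinitesimal_contraction {E : Type*} [NormedAddCommGroup E]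
    [NormedSpace ℝ E] {z z' : ℝ → E} {r α ρ : ℝ} (hα : 0 < α)
    (hz : ∀ t, 0 ≤ t → HasDerivWithinAt z (z' t) (Set.Ici 0) t)
    (hc : ∀ t, 0 ≤ t → ‖z t‖ ≤ r →
      ∀ᶠ h in 𝓝[>] (0 : ℝ), ‖z t + h • z' t‖ ≤ (1 - α * h) * ‖z t‖)
    (hρ : 0 < ρ) (hρr : ρ ≤ r) (h0 : ‖z 0‖ ≤ ρ) (t : ℝ) (ht : 0 ≤ t) :
    ‖z t‖ ≤ ρ * Real.exp (-(α / 2) * t) := by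
  have hz' : ∀ s, 0 ≤ s → HasDerivWithinAt z (z' s) (Set.Ici s) s := fun s hs =>
    (hz s hs).mono (Set.Ici_subset_Ici.2 hs)
  refine image_le_of_liminf_slope_right_lt_deriv_boundary (f := fun s => ‖z s‖)
    -- The second branch only supplies some valid slope bound outside the ball; at a contact with
    -- the barrier the curve is inside it.
    (f' := fun s => if ‖z s‖ ≤ r then -α * ‖z s‖ else ‖z' s‖)
    -- Halving the rate gives the strict derivative inequality required at contact points.
    (B := fun s => ρ * Real.exp (-(α / 2) * s))
    (B' := fun s => ρ * (Real.exp (-(α / 2) * s) * -(α / 2))) (a := 0) (b := t)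
    ?_ ?_ (by simpa using h0) ?_ ?_ ⟨ht, le_rfl⟩
  · exact ContinuousOn.norm fun s hs =>
      (hz s hs.1).continuousWithinAt.mono Set.Icc_subset_Ici_self
  · intro s hs q hq
    by_cases hsr : ‖z s‖ ≤ r
    · simp only [hsr, if_true] at hq
      obtain ⟨ε, hε, hεq⟩ : ∃ ε > 0, -α * ‖z s‖ + ε < q :=
        ⟨(q - -α * ‖z s‖) / 2, by linarith, by linarith⟩
      have hlo := ((hasDerivWithinAt_iff_isLittleO.1 (hz' s hs.1)).def hε).filter_mono
        (nhdsWithin_mono s Set.Ioi_subset_Ici_self)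
      have hsub : Tendsto (fun u => u - s) (𝓝[>] s) (𝓝[>] 0) := by
        refine tendsto_nhdsWithin_iff.2 ⟨?_, ?_⟩
        · have : Tendsto (fun u => u - s) (𝓝 s) (𝓝 (s - s)) :=
            (continuous_id.sub continuous_const).tendsto s
          rw [sub_self] at this
          exact this.mono_left nhdsWithin_le_nhds
        · filter_upwards [self_mem_nhdsWithin] with u hu using sub_pos.2 (Set.mem_Ioi.1 hu)
      refine Eventually.frequently ?_
      filter_upwards [hlo, hsub.eventually (hc s hs.1 hsr), self_mem_nhdsWithin] with u h1 h2 h3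
      have hpos : 0 < u - s := sub_pos.2 h3
      rw [Real.norm_of_nonneg hpos.le] at h1
      have h4 : ‖z u‖ ≤ ‖z s + (u - s) • z' s‖ + ‖z u - z s - (u - s) • z' s‖ := by
        refine le_trans (le_of_eq ?_) (norm_add_le _ _)
        congr 1; abel
      rw [slope_def_field, div_lt_iff₀ hpos]
      nlinarith
    · simp only [hsr, if_false] at hq
      simpa only [slope_def_field, div_eq_inv_mul] using
        (hz' s hs.1).liminf_right_slope_norm_le hq
  · intro s
    have : HasDerivAt (fun s => -(α / 2) * s) (-(α / 2)) s := by
      simpa using (hasDerivAt_id s).const_mul (-(α / 2))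
    exact this.exp.const_mul ρ
  · intro s hs hsB
    have hexp : Real.exp (-(α / 2) * s) ≤ 1 := Real.exp_le_one_iff.2 (by nlinarith [hs.1])
    have hle : ‖z s‖ ≤ r := by rw [hsB]; nlinarith
    have hpos : 0 < ρ * Real.exp (-(α / 2) * s) := by positivity
    simp only [hle, if_true]
    have hsB' : ‖z s‖ = ρ * Real.exp (-(α / 2) * s) := hsB
    rw [hsB']
    nlinarith

/-- Local exponential contraction in the norm `‖D ·‖` implies local asymptotic stability. The
bounded Lipschitz field `g` coinciding with `f` near `xbar` provides the solutions. -/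
theorem locallyAsymptoticallyStable_of_infinitesimal_contraction {E : Type*}
    [NormedAddCommGroup E] [NormedSpace ℝ E] [CompleteSpace E] {f g : E → E} {xbar : E}
    (D : E ≃L[ℝ] E) {α : ℝ} (hα : 0 < α)
    (hc : ∀ᶠ x in 𝓝 xbar, ∀ᶠ h in 𝓝[>] (0 : ℝ),
      ‖D (x - xbar) + h • D (f x)‖ ≤ (1 - α * h) * ‖D (x - xbar)‖)
    {K M : NNReal} (hg : LipschitzWith K g) (hM : ∀ x, ‖g x‖ ≤ M) (hfg : f =ᶠ[𝓝 xbar] g) :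
    (∃ A ∈ 𝓝 xbar, ∀ x₀ ∈ A,
      (∃ x : ℝ → E, IsIntegralCurveOn x (fun _ => f) (Set.Ici 0) ∧ x 0 = x₀) ∧
      ∀ x : ℝ → E, IsIntegralCurveOn x (fun _ => f) (Set.Ici 0) → x 0 = x₀ →
        Tendsto (fun t => ‖x t - xbar‖) atTop (𝓝 0)) ∧
    (∀ ε > (0 : ℝ), ∃ δ > (0 : ℝ), ∀ x : ℝ → E, IsIntegralCurveOn x (fun _ => f) (Set.Ici 0) →
      ‖x 0 - xbar‖ < δ → ∀ t : ℝ, 0 ≤ t → ‖x t - xbar‖ < ε) := by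
  obtain ⟨C, hC0, hC⟩ : ∃ C > 0, ∀ v, ‖v‖ ≤ C * ‖D v‖ := by
    obtain ⟨C, hC0, hC⟩ := (D.symm : E →L[ℝ] E).bound
    exact ⟨C, hC0, fun v => by simpa using hC (D v)⟩
  obtain ⟨C', hC'0, hC'⟩ : ∃ C > 0, ∀ v, ‖D v‖ ≤ C * ‖v‖ := (D : E →L[ℝ] E).bound
  obtain ⟨r, hr, hball⟩ : ∃ r > 0, ∀ x, ‖D (x - xbar)‖ ≤ r → f x = g x ∧
      ∀ᶠ h in 𝓝[>] (0 : ℝ), ‖D (x - xbar) + h • D (f x)‖ ≤ (1 - α * h) * ‖D (x - xbar)‖ := by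
    obtain ⟨r, hr, hsub⟩ := Metric.eventually_nhds_iff.1 (hfg.and hc)
    refine ⟨r / (2 * C), by positivity, fun x hx => hsub ?_⟩
    rw [dist_eq_norm]
    calc ‖x - xbar‖ ≤ C * ‖D (x - xbar)‖ := hC _
      _ ≤ C * (r / (2 * C)) := by gcongr
      _ = r / 2 := by field_simp
      _ < r := by linarith
  have decay : ∀ (F : E → E) (x : ℝ → E), (∀ y, ‖D (y - xbar)‖ ≤ r → F y = f y) →
      IsIntegralCurveOn x (fun _ => F) (Set.Ici 0) → ∀ ρ, 0 < ρ → ρ ≤ r →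
      ‖D (x 0 - xbar)‖ ≤ ρ → ∀ t, 0 ≤ t →
      ‖D (x t - xbar)‖ ≤ ρ * Real.exp (-(α / 2) * t) := by
    intro F x hF hx ρ hρ hρr h0 t ht
    refine norm_le_exp_of_infinitesimal_contraction (z := fun t => D (x t - xbar))
      (z' := fun t => D (F (x t))) hα (fun s hs => ?_) (fun s hs hsr => ?_) hρ hρr h0 t ht
    · exact (D : E →L[ℝ] E).hasFDerivAt.comp_hasDerivWithinAt s ((hx s hs).sub_const xbar)
    · rw [hF _ hsr]
      exact (hball _ hsr).2
  have hexp : ∀ t, 0 ≤ t → Real.exp (-(α / 2) * t) ≤ 1 := fun t ht =>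
    Real.exp_le_one_iff.2 (by nlinarith)
  refine ⟨⟨{x | ‖D (x - xbar)‖ < r}, ?_, fun x₀ hx₀ => ⟨?_, ?_⟩⟩, fun ε hε => ?_⟩
  · have hcont : Continuous fun x => ‖D (x - xbar)‖ := by fun_prop
    exact (isOpen_lt hcont continuous_const).mem_nhds (by simpa using hr)
  · obtain ⟨x, hx0, hx⟩ := hg.exists_isIntegralCurveOn_Ici hM x₀
    refine ⟨x, fun t ht => ?_, hx0⟩
    -- The decay estimate holds for the truncated field too; it confines its solution to the ball
    -- where both fields agree.
    have h1 := decay g x (fun y hy => (hball y hy).1.symm) hx r hr le_rfl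
      (by rw [hx0]; exact le_of_lt hx₀) t ht
    have h2 : ‖D (x t - xbar)‖ ≤ r := h1.trans (mul_le_of_le_one_right hr.le (hexp t ht))
    change HasDerivWithinAt x (f (x t)) (Set.Ici 0) t
    rw [(hball _ h2).1]
    exact hx t ht
  · intro x hx hx0
    have hlim : Tendsto (fun t : ℝ => C * (r * Real.exp (-(α / 2) * t))) atTop (𝓝 0) := by
      have h1 : Tendsto (fun t : ℝ => -(α / 2) * t) atTop atBot :=
        tendsto_id.const_mul_atTop_of_neg (by linarith)
      simpa using ((Real.tendsto_exp_atBot.comp h1).const_mul r).const_mul C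
    refine squeeze_zero' (Eventually.of_forall fun _ => norm_nonneg _) ?_ hlim
    filter_upwards [eventually_ge_atTop 0] with t ht
    refine (hC _).trans ?_
    gcongr
    exact decay f x (fun _ _ => rfl) hx r hr le_rfl (by rw [hx0]; exact le_of_lt hx₀) t ht
  · obtain ⟨ρ, hρ, hρr, hρε⟩ : ∃ ρ > 0, ρ ≤ r ∧ C * ρ < ε := by
      refine ⟨min r (ε / (2 * C)), by positivity, min_le_left _ _, ?_⟩
      calc C * min r (ε / (2 * C)) ≤ C * (ε / (2 * C)) := by gcongr; exact min_le_right _ _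
        _ = ε / 2 := by field_simp
        _ < ε := by linarith
    refine ⟨ρ / C', by positivity, fun x hx h0 t ht => ?_⟩
    have h0' : ‖D (x 0 - xbar)‖ ≤ ρ := by
      refine (hC' _).trans ?_
      rw [lt_div_iff₀ hC'0] at h0
      linarith
    have h1 := decay f x (fun _ _ => rfl) hx ρ hρ hρr h0' t ht
    calc ‖x t - xbar‖ ≤ C * ‖D (x t - xbar)‖ := hC _
      _ ≤ C * (ρ * 1) := by gcongr; exact h1.trans (by gcongr; exact hexp t ht)
      _ < ε := by simpa using hρε

/-! ### Truncation of a smooth field -/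

/-- A `C¹` map on a product of coordinate spaces coincides near any point with a bounded, globally
Lipschitz map. -/
theorem exists_lipschitzWith_bounded_eventuallyEq_of_contDiff {ι κ F : Type*} [Fintype ι] [Fintype κ]
    [NormedAddCommGroup F] [NormedSpace ℝ F] {f : (ι → ℝ) × (κ → ℝ) → F} (hf : ContDiff ℝ 1 f)
    (x₀ : (ι → ℝ) × (κ → ℝ)) :
    ∃ (g : (ι → ℝ) × (κ → ℝ) → F) (K M : NNReal),
      LipschitzWith K g ∧ (∀ x, ‖g x‖ ≤ M) ∧ f =ᶠ[𝓝 x₀] g := by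
  -- Coordinatewise clipping to the unit sup-norm ball around `x₀`: it is 1-Lipschitz, and the ball
  -- is compact and convex.
  let c : (ι → ℝ) × (κ → ℝ) → (ι → ℝ) × (κ → ℝ) := fun x =>
    (fun i => max (x₀.1 i - 1) (min (x₀.1 i + 1) (x.1 i)),
      fun b => max (x₀.2 b - 1) (min (x₀.2 b + 1) (x.2 b)))
  have hc : LipschitzWith 1 c := by
    have h1 : ∀ i, LipschitzWith 1 fun x : (ι → ℝ) × (κ → ℝ) => x.1 i := fun i => by
      simpa [Function.comp_def] using (LipschitzWith.eval i).comp
        (LipschitzWith.prod_fst (α := ι → ℝ) (β := κ → ℝ))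
    have h2 : ∀ b, LipschitzWith 1 fun x : (ι → ℝ) × (κ → ℝ) => x.2 b := fun b => by
      simpa [Function.comp_def] using (LipschitzWith.eval b).comp
        (LipschitzWith.prod_snd (α := ι → ℝ) (β := κ → ℝ))
    have := LipschitzWith.prodMk
      (LipschitzWith.of_dist_le_mul (K := 1) (f := fun x => (c x).1) fun x y => by
        refine (dist_pi_le_iff (by positivity)).2 fun i => ?_
        exact (((h1 i).const_min _).const_max _).dist_le_mul x y)
      (LipschitzWith.of_dist_le_mul (K := 1) (f := fun x => (c x).2) fun x y => by
        refine (dist_pi_le_iff (by positivity)).2 fun b => ?_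
        exact (((h2 b).const_min _).const_max _).dist_le_mul x y)
    simpa using this
  have hmem : ∀ x, c x ∈ Metric.closedBall x₀ 1 := by
    intro x
    have key : ∀ a b : ℝ, dist (max (a - 1) (min (a + 1) b)) a ≤ 1 := by
      intro a b
      rw [Real.dist_eq, abs_le]
      constructor
      · linarith [le_max_left (a - 1) (min (a + 1) b)]
      · have : max (a - 1) (min (a + 1) b) ≤ a + 1 :=
          max_le (by linarith) (min_le_left _ _)
        linarith
    rw [Metric.mem_closedBall, Prod.dist_eq]
    exact max_le ((dist_pi_le_iff zero_le_one).2 fun i => key _ _)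
      ((dist_pi_le_iff zero_le_one).2 fun b => key _ _)
  have hcomp : IsCompact (Metric.closedBall x₀ 1) := isCompact_closedBall x₀ 1
  obtain ⟨K, hK⟩ := hf.contDiffOn.exists_lipschitzOnWith one_ne_zero (convex_closedBall x₀ 1) hcomp
  obtain ⟨M, hM⟩ := hcomp.exists_bound_of_continuousOn hf.continuous.continuousOn
  refine ⟨f ∘ c, K * 1, M.toNNReal, ?_, fun x => (hM _ (hmem x)).trans (Real.le_coe_toNNReal M), ?_⟩
  · rw [← lipschitzOnWith_univ]
    exact hK.comp hc.lipschitzOnWith fun x _ => hmem x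
  · filter_upwards [Metric.closedBall_mem_nhds x₀ one_pos] with x hx
    have key : ∀ a b : ℝ, dist b a ≤ 1 → max (a - 1) (min (a + 1) b) = b := by
      intro a b h
      rw [Real.dist_eq, abs_le] at h
      rw [min_eq_right (by linarith), max_eq_right (by linarith)]
    rw [Metric.mem_closedBall, Prod.dist_eq] at hx
    have hcx : c x = x := Prod.ext
      (funext fun i => key _ _ ((dist_le_pi_dist _ _ i).trans ((le_max_left _ _).trans hx)))
      (funext fun b => key _ _ ((dist_le_pi_dist _ _ b).trans ((le_max_right _ _).trans hx)))
    simp [hcx]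

/-! ### Conductance identities and the scalar Euler step -/

namespace ResistiveNetwork

variable {N : Type*}

theorem adjacency_nonneg (S : ResistiveNetwork N) (i j : N) : 0 ≤ S.adjacency i j := by
  unfold adjacency
  simp only [Matrix.of_apply]
  split_ifs with h
  · exact (one_div_pos.2 (S.R_line_pos i j h)).le
  · exact le_rfl

variable [Fintype N] [DecidableEq N]

theorem sum_conductance_mul (S : ResistiveNetwork N) (v : N → ℝ) (i : N) :
    ∑ j, S.conductance i j * v j = ∑ j, S.adjacency i j * (v i - v j) + v i / S.R i i := by
  simp only [conductance, laplacian, Matrix.add_apply, Matrix.sub_apply, Matrix.diagonal_apply,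
    add_mul, sub_mul, mul_sub, Finset.sum_add_distrib, Finset.sum_sub_distrib, ite_mul, zero_mul,
    Finset.sum_ite_eq, Finset.mem_univ, if_true, Finset.sum_mul]
  ring

theorem sum_invR (S : ResistiveNetwork N) (i : N) :
    ∑ j, S.invR i j = ∑ j, S.adjacency i j + 1 / S.R i i := by
  have h : ∀ j, S.invR i j = S.adjacency i j + if i = j then 1 / S.R i i else 0 := by
    intro j
    by_cases hij : i = j
    · subst hij
      simp [invR, adjacency]
    · by_cases hA : S.graph.Adj i j <;> simp [invR, adjacency, hij, hA]
  simp [h, Finset.sum_add_distrib]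

end ResistiveNetwork

/-- One explicit Euler step of a scalar linear equation with damping `a` and a perturbation that
is dominated by `b * n` contracts the bound `n`. -/
theorem abs_add_euler_step_le {v w a b c h n α : ℝ} (hv : |v| ≤ n) (hw : |w| ≤ b * n)
    (hc : 0 ≤ c) (hh : 0 ≤ h) (hstep : h * (c * a) ≤ 1) (hα : α ≤ c * (a - b)) :
    |v + h * (c * (-a * v + w))| ≤ (1 - α * h) * n := by
  have hn : 0 ≤ n := (abs_nonneg v).trans hv
  calc |v + h * (c * (-a * v + w))| = |(1 - h * (c * a)) * v + h * c * w| := by ring_nf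
    _ ≤ |(1 - h * (c * a)) * v| + |h * c * w| := abs_add_le _ _
    _ = (1 - h * (c * a)) * |v| + h * c * |w| := by
      rw [abs_mul, abs_mul, abs_of_nonneg (sub_nonneg.2 hstep), abs_of_nonneg (mul_nonneg hh hc)]
    _ ≤ (1 - h * (c * a)) * n + h * c * (b * n) := by
      have := sub_nonneg.2 hstep
      gcongr
    _ = (1 - c * (a - b) * h) * n := by ring
    _ ≤ (1 - α * h) * n := by gcongr

/-! ### Diagonal dominance of the micro-grid -/

namespace MicroGrid

variable {B Q : Type*}

/-- The bounded-integral gain multiplying the droop law at node `i`. -/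
noncomputable def gain (g : MicroGrid B Q) (x : State B Q) (i : B ⊕ Q) : ℝ :=
  (g.τv i)⁻¹ * (1 - (x.1 i - g.Vstar) ^ 2 / g.ΔV i ^ 2)

theorem gain_pos (g : MicroGrid B Q) {x : State B Q} {i : B ⊕ Q}
    (h : |x.1 i - g.Vstar| < g.ΔV i) : 0 < g.gain x i := by
  refine mul_pos (inv_pos.2 (g.τv_pos i)) (sub_pos.2 ?_)
  rw [div_lt_one (pow_pos (g.ΔV_pos i) 2)]
  exact sq_lt_sq' (neg_lt_of_abs_lt h) (lt_of_abs_lt h)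

theorem continuous_gain (g : MicroGrid B Q) (i : B ⊕ Q) : Continuous fun x => g.gain x i := by
  unfold gain
  fun_prop

variable [Fintype B] [Fintype Q] [DecidableEq B] [DecidableEq Q]

/-- The diagonal dominance margin of the voltage dynamics around `xbar`, for a weight `s` of the
power references. -/
noncomputable def margin (g : MicroGrid B Q) (xbar : State B Q) (s : ℝ) (x : State B Q)
    (i : B ⊕ Q) : ℝ :=
  1 + g.k i * ∑ j, g.net.conductance i j * x.1 j + g.k i * xbar.1 i / g.net.R i i - g.k i / s

theorem continuous_margin (g : MicroGrid B Q) (xbar : State B Q) (s : ℝ) (i : B ⊕ Q) :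
    Continuous fun x => g.margin xbar s x i := by
  unfold margin
  fun_prop

theorem contDiff_field (g : MicroGrid B Q) : ContDiff ℝ 1 g.field := by
  have hS : ∀ i : B ⊕ Q, ContDiff ℝ 1 fun x : State B Q => Sum.elim x.2 g.Pr i := by
    rintro (b | q)
    · simp only [Sum.elim_inl]
      fun_prop
    · simp only [Sum.elim_inr]
      fun_prop
  refine ContDiff.prodMk (contDiff_pi.2 fun i => ?_) (contDiff_pi.2 fun b => ?_)
  · have := hS i
    unfold voltageField
    fun_prop
  · unfold demandField
    fun_prop

/-- At an equilibrium inside the bounds the droop law is satisfied. -/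
theorem IsEquilibrium.droop {g : MicroGrid B Q} {xbar : State B Q} (heq : g.IsEquilibrium xbar)
    {i : B ⊕ Q} (hin : |xbar.1 i - g.Vstar| < g.ΔV i) :
    g.Vstar - xbar.1 i - g.k i * (xbar.1 i * ∑ j, g.net.conductance i j * xbar.1 j)
      + g.k i * Sum.elim xbar.2 g.Pr i = 0 := by
  have h1 : g.voltageField xbar i = 0 := congrFun (congrArg Prod.fst heq) i
  have h2 : g.gain xbar i * (g.Vstar - xbar.1 i
      - g.k i * (xbar.1 i * ∑ j, g.net.conductance i j * xbar.1 j)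
      + g.k i * Sum.elim xbar.2 g.Pr i) = 0 := by
    rw [← h1, voltageField, gain, Finset.mul_sum]
    simp only [mul_left_comm, mul_assoc]
    ring
  exact (mul_eq_zero.1 h2).resolve_left (g.gain_pos hin).ne'

theorem IsEquilibrium.demand {g : MicroGrid B Q} {xbar : State B Q} (heq : g.IsEquilibrium xbar)
    (b : B) : xbar.2 b = g.Pd b := by
  have h1 : g.demandField xbar b = 0 := congrFun (congrArg Prod.snd heq) b
  have h2 := (mul_eq_zero.1 h1).resolve_left (inv_pos.2 (g.τ_pos b)).ne'
  linarith

/-- The voltage field in error coordinates. -/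
theorem IsEquilibrium.voltageField_eq {g : MicroGrid B Q} {xbar : State B Q}
    (heq : g.IsEquilibrium xbar) (x : State B Q) {i : B ⊕ Q}
    (hin : |xbar.1 i - g.Vstar| < g.ΔV i) :
    g.voltageField x i = g.gain x i *
      (-(1 + g.k i * ∑ j, g.net.conductance i j * x.1 j
          + g.k i * xbar.1 i * (∑ j, g.net.adjacency i j + 1 / g.net.R i i)) * (x - xbar).1 i
        + g.k i * (xbar.1 i * ∑ j, g.net.adjacency i j * (x - xbar).1 j
          + Sum.elim (x - xbar).2 (fun _ => 0) i)) := by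
  have hP : Sum.elim (x - xbar).2 (fun _ => (0 : ℝ)) i
      = Sum.elim x.2 g.Pr i - Sum.elim xbar.2 g.Pr i := by
    rcases i with b | q <;> simp
  have hV : ∑ j, g.net.conductance i j * x.1 i * x.1 j
      = x.1 i * ∑ j, g.net.conductance i j * x.1 j := by
    rw [Finset.mul_sum]
    exact Finset.sum_congr rfl fun j _ => by ring
  have hG : ∑ j, g.net.conductance i j * x.1 j - ∑ j, g.net.conductance i j * xbar.1 j
      = (∑ j, g.net.adjacency i j + 1 / g.net.R i i) * (x - xbar).1 i
        - ∑ j, g.net.adjacency i j * (x - xbar).1 j := by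
    rw [← Finset.sum_sub_distrib]
    simp only [← mul_sub]
    have := g.net.sum_conductance_mul (x - xbar).1 i
    simp only [Prod.fst_sub, Pi.sub_apply, mul_sub, Finset.sum_sub_distrib] at this ⊢
    rw [this]
    simp only [← Finset.sum_mul]
    ring
  have hd := heq.droop hin
  rw [voltageField, hV, hP, gain]
  simp only [Prod.fst_sub, Pi.sub_apply] at hG ⊢
  rw [mul_comm (_ + _ : ℝ) (1 - _), ← mul_assoc]
  congr 1
  -- This is the splitting `x i * (G x) i - xbar i * (G xbar) i = (x i - xbar i) * (G x) i + xbar i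
  -- * (G (x - xbar)) i` for the voltages.
  linear_combination hd - g.k i * xbar.1 i * hG

/-- Two voltages differ by at most `2 * ΔV` and each is at least `Vstar - ΔV`. Inserting this makes
the left side at least twice the slack in `hcond`, which explains the `1 / 2` there. -/
theorem margin_pos (g : MicroGrid B Q) {xbar : State B Q} {ΔV : ℝ}
    (hbound : ∀ i, |xbar.1 i - g.Vstar| ≤ ΔV)
    (hcond : ∀ i, g.k i * ΔV * ∑ j, g.net.invR i j < 1 / 2 + g.k i * (g.Vstar / g.net.R i i))
    (i : B ⊕ Q) :
    0 < 1 + g.k i * ∑ j, g.net.conductance i j * xbar.1 j + g.k i * xbar.1 i / g.net.R i i := by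
  have hk := g.k_pos i
  have hR : 0 < 1 / g.net.R i i := one_div_pos.2 (g.net.R_shunt_pos i)
  have hb : ∀ j, g.Vstar - ΔV ≤ xbar.1 j ∧ xbar.1 j ≤ g.Vstar + ΔV := fun j => by
    have := abs_le.1 (hbound j)
    constructor <;> linarith
  have h1 : -(2 * ΔV) * ∑ j, g.net.adjacency i j
      ≤ ∑ j, g.net.adjacency i j * (xbar.1 i - xbar.1 j) := by
    rw [Finset.mul_sum]
    refine Finset.sum_le_sum fun j _ => ?_
    rw [mul_comm]
    refine mul_le_mul_of_nonneg_left ?_ (g.net.adjacency_nonneg i j)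
    linarith [(hb i).1, (hb j).2]
  have h2 : (g.Vstar - ΔV) * (1 / g.net.R i i) ≤ xbar.1 i * (1 / g.net.R i i) :=
    mul_le_mul_of_nonneg_right (hb i).1 hR.le
  have h3 := hcond i
  rw [g.net.sum_invR] at h3
  rw [g.net.sum_conductance_mul]
  -- `h2` enters twice: the shunt occurs once inside the conductance sum and once as a separate
  -- term.
  have h4 := mul_le_mul_of_nonneg_left (add_le_add h1 (add_le_add h2 h2)) hk.le
  simp only [div_eq_mul_one_div g.Vstar, div_eq_mul_one_div (xbar.1 i),
    div_eq_mul_one_div (g.k i * xbar.1 i)] at *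
  nlinarith

/-- Near the equilibrium the Euler map contracts distances to the equilibrium in the weighted
supremum norm. -/
theorem IsEquilibrium.norm_euler_step_le {g : MicroGrid B Q} {xbar : State B Q}
    (heq : g.IsEquilibrium xbar) (hin : ∀ i, |xbar.1 i - g.Vstar| < g.ΔV i)
    (hnonneg : ∀ i, 0 ≤ xbar.1 i) {s α : ℝ} (hs : 0 < s) (hατ : ∀ b, α ≤ (g.τ b)⁻¹)
    {x : State B Q} (hgain : ∀ i, 0 < g.gain x i)
    (hα : ∀ i, α ≤ g.gain x i * g.margin xbar s x i) (D : State B Q ≃L[ℝ] State B Q)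
    (hD : ∀ y, D y = (y.1, s • y.2)) :
    ∀ᶠ h in 𝓝[>] (0 : ℝ),
      ‖D (x - xbar) + h • D (g.field x)‖ ≤ (1 - α * h) * ‖D (x - xbar)‖ := by
  -- Small steps keep the diagonal weights of the Euler map and the factor `1 - α * h` nonnegative.
  have small : ∀ a : ℝ, ∀ᶠ h in 𝓝[>] (0 : ℝ), h * a ≤ 1 := fun a => by
    have : ∀ᶠ h in 𝓝 (0 : ℝ), h * a < 1 :=
      (continuous_id.mul continuous_const).continuousAt.eventually_lt continuousAt_const (by simp)
    exact (this.filter_mono nhdsWithin_le_nhds).mono fun _ h => h.le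
  set a : B ⊕ Q → ℝ := fun i => 1 + g.k i * ∑ j, g.net.conductance i j * x.1 j
          + g.k i * xbar.1 i * (∑ j, g.net.adjacency i j + 1 / g.net.R i i) with ha
  set n := ‖D (x - xbar)‖ with hn
  have hn1 : ∀ i, |(x - xbar).1 i| ≤ n := fun i => by
    rw [hn, hD]
    exact (norm_le_pi_norm (x - xbar).1 i).trans (le_max_left _ _)
  have hn2 : ∀ b, |s * (x - xbar).2 b| ≤ n := fun b => by
    rw [hn, hD]
    exact (norm_le_pi_norm (s • (x - xbar).2) b).trans (le_max_right _ _)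
  have hn0 : 0 ≤ n := norm_nonneg _
  filter_upwards [eventually_all.2 fun i => small (g.gain x i * a i),
    eventually_all.2 fun b => small ((g.τ b)⁻¹ * 1), small α, self_mem_nhdsWithin]
    with h h1 h2 h4 h3
  have hh : 0 ≤ h := le_of_lt h3
  have hV : ∀ i, |(x - xbar).1 i + h * g.voltageField x i| ≤ (1 - α * h) * n := by
    intro i
    have hk := g.k_pos i
    rw [heq.voltageField_eq x (hin i)]
    -- Here `b` is the absolute row sum of the off-diagonal coefficients, with `1 / s` from
    -- rescaling the power error. As `xbar.1 i ≥ 0`, the adjacency sums cancel in `a i - b`, leaving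
    -- exactly `margin`.
    refine abs_add_euler_step_le (b := g.k i * (xbar.1 i * ∑ j, g.net.adjacency i j + 1 / s))
      (hn1 i) ?_ (hgain i).le hh (h1 i) ((hα i).trans_eq ?_)
    · rw [abs_mul, abs_of_pos hk, mul_assoc]
      refine mul_le_mul_of_nonneg_left ((abs_add_le _ _).trans ?_) hk.le
      rw [add_mul]
      refine add_le_add ?_ ?_
      · rw [abs_mul, abs_of_nonneg (hnonneg i), mul_assoc, Finset.sum_mul]
        refine mul_le_mul_of_nonneg_left ((Finset.abs_sum_le_sum_abs _ _).trans ?_) (hnonneg i)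
        refine Finset.sum_le_sum fun j _ => ?_
        rw [abs_mul, abs_of_nonneg (g.net.adjacency_nonneg i j)]
        exact mul_le_mul_of_nonneg_left (hn1 j) (g.net.adjacency_nonneg i j)
      · rcases i with b | q
        · have := hn2 b
          rw [abs_mul, abs_of_pos hs] at this
          rw [Sum.elim_inl, one_div_mul_eq_div, le_div_iff₀ hs]
          linarith
        · simp only [Sum.elim_inr, abs_zero]
          positivity
    · simp only [margin]
      ring
  have hP : ∀ b, |s * (x - xbar).2 b + h * (s * g.demandField x b)| ≤ (1 - α * h) * n := by
    intro b
    have := abs_add_euler_step_le (w := 0) (a := 1) (b := 0) (hn2 b) (by simp)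
      (inv_pos.2 (g.τ_pos b)).le hh (h2 b) (by simpa using hατ b)
    convert! this using 2
    simp only [demandField, ← heq.demand b, Prod.snd_sub, Pi.sub_apply]
    ring
  have hnonneg' : 0 ≤ (1 - α * h) * n :=
    mul_nonneg (by linarith) hn0
  rw [hD, hD, Prod.norm_def]
  refine max_le ((pi_norm_le_iff_of_nonneg hnonneg').2 fun i => ?_)
    ((pi_norm_le_iff_of_nonneg hnonneg').2 fun b => ?_)
  · simpa [field, Real.norm_eq_abs] using hV i
  · simpa [field, Real.norm_eq_abs] using hP b

end MicroGrid

theorem mainTheorem7 {B Q : Type*} [Fintype B] [Fintype Q] [DecidableEq B] [DecidableEq Q]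
    (g : MicroGrid B Q) (xbar : MicroGrid.State B Q) (ΔV : ℝ)
    (heq : g.IsEquilibrium xbar)
    (hinside : ∀ i, |xbar.1 i - g.Vstar| < g.ΔV i)
    (hbound : ∀ i, |xbar.1 i - g.Vstar| ≤ ΔV)
    (hnonneg : ∀ i, 0 ≤ xbar.1 i)
    (hcond : ∀ i, g.k i * ΔV * ∑ j, g.net.invR i j < 1 / 2 + g.k i * (g.Vstar / g.net.R i i)) :
    -- local attractivity (with global forward existence of the solutions)
    (∃ A ∈ 𝓝 xbar, ∀ x₀ ∈ A,
      (∃ x : ℝ → MicroGrid.State B Q, g.IsSolution x ∧ x 0 = x₀) ∧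
      ∀ x : ℝ → MicroGrid.State B Q, g.IsSolution x → x 0 = x₀ →
        Tendsto (fun t => ‖x t - xbar‖) atTop (𝓝 0)) ∧
    -- Lyapunov stability
    (∀ ε > (0 : ℝ), ∃ δ > (0 : ℝ), ∀ x : ℝ → MicroGrid.State B Q, g.IsSolution x → ‖x 0 - xbar‖ < δ →
      ∀ t : ℝ, 0 ≤ t → ‖x t - xbar‖ < ε) := by
  -- The unweighted margin is positive, so subtracting `k i / s` is harmless for all large `s`.
  obtain ⟨s, hs, hms⟩ : ∃ s > 0, ∀ i, 0 < g.margin xbar s xbar i := by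
    have h : ∀ i, ∀ᶠ s : ℝ in atTop, 0 < g.margin xbar s xbar i := by
      intro i
      have h0 : Tendsto (fun s : ℝ => g.k i / s) atTop (𝓝 0) :=
        tendsto_const_nhds.div_atTop tendsto_id
      filter_upwards [h0.eventually (gt_mem_nhds (g.margin_pos hbound hcond i))] with s hs
      exact sub_pos.2 hs
    exact ((eventually_gt_atTop 0).and (eventually_all.2 h)).exists
  obtain ⟨α, hα, hατ, hαm⟩ : ∃ α > 0, (∀ b, α < (g.τ b)⁻¹) ∧
      ∀ i, α < g.gain xbar i * g.margin xbar s xbar i := by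
    have h : ∀ c : ℝ, 0 < c → ∀ᶠ α in 𝓝[>] (0 : ℝ), α < c := fun c hc =>
      mem_nhdsWithin_of_mem_nhds (gt_mem_nhds hc)
    exact (eventually_mem_nhdsWithin.and
      ((eventually_all.2 fun b => h _ (inv_pos.2 (g.τ_pos b))).and
        (eventually_all.2 fun i => h _ (mul_pos (g.gain_pos (hinside i)) (hms i))))).exists
  let D : MicroGrid.State B Q ≃L[ℝ] MicroGrid.State B Q :=
    (ContinuousLinearEquiv.refl ℝ (B ⊕ Q → ℝ)).prodCongr
      (ContinuousLinearEquiv.smulLeft (Units.mk0 s hs.ne'))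
  obtain ⟨f, K, M, hf, hM, hfg⟩ :=
    exists_lipschitzWith_bounded_eventuallyEq_of_contDiff g.contDiff_field xbar
  refine locallyAsymptoticallyStable_of_infinitesimal_contraction D hα ?_ hf hM hfg
  have h1 : ∀ᶠ x in 𝓝 xbar, ∀ i, 0 < g.gain x i := eventually_all.2 fun i =>
    (g.continuous_gain i).continuousAt.eventually (lt_mem_nhds (g.gain_pos (hinside i)))
  have h2 : ∀ᶠ x in 𝓝 xbar, ∀ i, α < g.gain x i * g.margin xbar s x i := eventually_all.2 fun i =>
    ((g.continuous_gain i).mul (g.continuous_margin xbar s i)).continuousAt.eventually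
      (lt_mem_nhds (hαm i))
  filter_upwards [h1, h2] with x hx1 hx2
  exact heq.norm_euler_step_le hinside hnonneg hs (fun b => (hατ b).le) hx1
    (fun i => (hx2 i).le) D fun y => rfl
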